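/- For a real sequence $\mathbf q=(q_n)_{n\ge 0}$ write $a(\mathbf q)=\sum_{k\ge 2}k q_k$ and $$\mathcal F[\mathbf q]_n=\begin{cases}-a(\mathbf q)\,q_0,& n=0,\\ 2q_2-a(\mathbf q)(q_1-q_0),& n=1,\\ (n+1)q_{n+1}-nq_n-a(\mathbf q)(q_n-q_{n-1}),& n\ge 2.\end{cases}$$ Let $\mathcal S$ be the set of probability distributions $\mathbf q$ on $\mathbb N=\{0,1,2,\dots\}$ with finite mean, equipped with the norm $\|\mathbf q\|_{\mathcal S}=\sum_{n\ge 0}(1+n)|q_n|$. A (classical) solution of the discrete Fokker–Planck equation $$\mathbf p'(t)=\mathcal F[\mathbf p(t)],\qquad t\ge 0,$$ is a map $\mathbf p\in C([0,\infty);\mathcal S)\cap C^1([0,\infty);\ell^\infty)$ satisfying this equation. For $\mu>1$ put $\nu=\mu+W_0(-\mu e^{-\mu})$, where $W_0$ is the principal branch of the Lambert function (for $x\ge -e^{-1}$, $W_0(x)$ is the unique $y\ge -1$ with $ye^y=x$), let $\overline{\mathbf p}$ be the zero-truncated Poisson distribution $$\overline p_0=0,\qquad \overline p_n=\frac{\nu^n}{n!}\cdot\frac{1}{e^\nu-1}\quad(n\ge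 1),$$ and write $\langle t\rangle=\sqrt{1+t^2}$. **Theorem.** Let $\mu>1$. There exist constants $C,K>0$ depending only on $\mu$ such that for every classical solution $\mathbf p$ whose initial value has mean $\sum_{n\ge 0} n\,p_n(0)=\mu$, and for all $t\ge 0$, $$\|\mathbf p(t)-\overline{\mathbf p}\|_{\ell^2}\le\begin{cases}C e^{-\nu t},&\nu<1,\\ C\langle t\rangle^{K}e^{-t},&\nu\ge 1.\end{cases}$$ -/

import Mathlib

noncomputable section

namespace Dispersion

/-- The probability distributions `q = (q_n)` on `ℕ` whose mean is finite, that is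
`∑ (1 + n) |q_n| < ∞`. -/
def ProbSeq : Set (ℕ → ℝ) :=
  {q | (∀ n, q n ∈ Set.Icc (0 : ℝ) 1) ∧ HasSum q 1 ∧ Summable fun n : ℕ => (n : ℝ) * q n}

/-- The weighted norm `∑ (1 + n) |q_n|`. -/
def weightedNorm (q : ℕ → ℝ) : ℝ := ∑' n : ℕ, (1 + (n : ℝ)) * |q n|

/-- The mean `∑ n q_n`. -/
def mean (q : ℕ → ℝ) : ℝ := ∑' n : ℕ, (n : ℝ) * q n

/-- The number of active particles per site, `∑_{n ≥ 2} n q_n`. -/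
def active (q : ℕ → ℝ) : ℝ := ∑' n : ℕ, if 2 ≤ n then (n : ℝ) * q n else 0

/-- The forward difference operator. -/
def diffFwd (q : ℕ → ℝ) (n : ℕ) : ℝ := q (n + 1) - q n

/-- The backward difference operator, with the convention `q_{-1} = 0`. -/
def diffBwd (q : ℕ → ℝ) : ℕ → ℝ
  | 0 => q 0
  | n + 1 => q (n + 1) - q n

/-- The generator `F[q] = D₊[(n 1_{n ≥ 2}) q] - D₋[a q]`, where `a = ∑_{k ≥ 2} k q_k`. -/
def generator (q : ℕ → ℝ) (n : ℕ) : ℝ :=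
  diffFwd (fun k => if 2 ≤ k then (k : ℝ) * q k else 0) n - diffBwd (fun k => active q * q k) n

theorem generator_zero (q : ℕ → ℝ) : generator q 0 = -(active q * q 0) := by
  simp [generator, diffFwd, diffBwd]

theorem generator_one (q : ℕ → ℝ) :
    generator q 1 = 2 * q 2 - active q * (q 1 - q 0) := by
  simp [generator, diffFwd, diffBwd]
  ring

theorem generator_of_two_le (q : ℕ → ℝ) (n : ℕ) (hn : 2 ≤ n) :
    generator q n = (n + 1) * q (n + 1) - n * q n - active q * (q n - q (n - 1)) := by
  obtain ⟨m, rfl⟩ : ∃ m, n = m + 1 := ⟨n - 1, by omega⟩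
  have h : 2 ≤ m + 1 + 1 := by omega
  simp only [generator, diffFwd, diffBwd, hn, h, if_true]
  push_cast
  simp
  ring

/-- Classical solutions on `[0, ∞)` of the discrete Fokker--Planck equation `p' = F[p]`:
`p(t)` is a probability distribution with finite mean for each `t ≥ 0`, `p` is continuous on
`[0, ∞)` for the weighted norm, it is continuously differentiable on `[0, ∞)` as a map into `ℓ^∞`
(one-sidedly at `0`), and it solves the equation. Values at negative times play no role. -/
structure IsClassicalSolution (p : ℝ → lp (fun _ : ℕ => ℝ) ⊤) : Prop where
  mem : ∀ t : ℝ, 0 ≤ t → (p t : ℕ → ℝ) ∈ ProbSeq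
  continuous : ∀ t : ℝ, 0 ≤ t →
    Filter.Tendsto (fun s => weightedNorm fun n => p s n - p t n)
      (nhdsWithin t (Set.Ici 0)) (nhds 0)
  contDiffOn : ContDiffOn ℝ 1 p (Set.Ici 0)
  eq : ∀ t : ℝ, 0 ≤ t → ∀ n : ℕ, derivWithin p (Set.Ici 0) t n = generator (p t) n

/-- The principal real branch of the Lambert function: for `x ≥ -e⁻¹`, the unique `y ≥ -1` with
`y e^y = x`. -/
def lambertW0 (x : ℝ) : ℝ :=
  Function.invFunOn (fun y : ℝ => y * Real.exp y) (Set.Ici (-1)) x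

theorem exists_mul_exp_eq {x : ℝ} (hx : -Real.exp (-1) ≤ x) :
    ∃ y ∈ Set.Ici (-1 : ℝ), y * Real.exp y = x := by
  have hc : ContinuousOn (fun y : ℝ => y * Real.exp y) (Set.Icc (-1) (max x 0)) := by fun_prop
  have h0 : (0 : ℝ) ≤ max x 0 := le_max_right _ _
  have h1 : (-1 : ℝ) ≤ max x 0 := by linarith
  have h2 : x ≤ max x 0 * Real.exp (max x 0) :=
    (le_max_left x 0).trans (le_mul_of_one_le_right h0 (Real.one_le_exp h0))
  obtain ⟨y, hy, hyx⟩ := intermediate_value_Icc h1 hc ⟨by simpa using hx, h2⟩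
  exact ⟨y, hy.1, hyx⟩

theorem lambertW0_spec {x : ℝ} (hx : -Real.exp (-1) ≤ x) :
    -1 ≤ lambertW0 x ∧ lambertW0 x * Real.exp (lambertW0 x) = x :=
  ⟨Function.invFunOn_mem (exists_mul_exp_eq hx), Function.invFunOn_eq (exists_mul_exp_eq hx)⟩

theorem strictMonoOn_mul_exp :
    StrictMonoOn (fun y : ℝ => y * Real.exp y) (Set.Ici (-1)) := by
  refine strictMonoOn_of_deriv_pos (convex_Ici _) (by fun_prop) fun y hy => ?_
  rw [interior_Ici] at hy
  have hd : HasDerivAt (fun y : ℝ => y * Real.exp y) (1 * Real.exp y + y * Real.exp y) y :=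
    (hasDerivAt_id y).mul (Real.hasDerivAt_exp y)
  rw [hd.deriv, ← add_mul]
  exact mul_pos (by linarith [Set.mem_Ioi.1 hy]) (Real.exp_pos y)

theorem lambertW0_eq {x y : ℝ} (hy : -1 ≤ y) (hyx : y * Real.exp y = x) : lambertW0 x = y := by
  have hx : ∃ y ∈ Set.Ici (-1 : ℝ), y * Real.exp y = x := ⟨y, hy, hyx⟩
  exact strictMonoOn_mul_exp.injOn (Function.invFunOn_mem hx) hy
    ((Function.invFunOn_eq hx).trans hyx.symm)

/-- The constant `ν = μ + W₀(-μ e^{-μ})`. -/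
def nu (μ : ℝ) : ℝ := μ + lambertW0 (-μ * Real.exp (-μ))

/-- The zero-truncated Poisson distribution with parameter `ν`. -/
def truncPoisson (ν : ℝ) (n : ℕ) : ℝ :=
  if n = 0 then 0 else ν ^ n / (n.factorial : ℝ) * (1 / (Real.exp ν - 1))

/-- The Japanese bracket `⟨t⟩ = √(1 + t²)`. -/
def bracket (t : ℝ) : ℝ := Real.sqrt (1 + t ^ 2)

end Dispersion

end

open Filter Topology

namespace Dispersion

/-! The proof is an `ℓ¹` estimate on the tails. The generator is in divergence form, so the tail
differences `x n = tailDiff μ (p t) n` solve a closed birth-death type system with damping; its only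
source is `(a - ν)` times the equilibrium, where `a = active (p t)`. Conservation of the mean
(`mean_eq`) gives `a - ν = x 2 - x 1` (`active_sub_nu`), and `x 1 = -p t 0`.

Let `W` be the sum of `|x n|` over `n ≥ 2`. Summing the linear part by parts leaves `-W - |x 2| + a
|x 1|`. The source costs at most `|x 2| + |x 1|`, so `|x 2|` cancels and `W' ≤ -W + (μ + 1) p₀`,
which is integrated in `exp_mul_sum_le`. Everything then depends on the mass `p₀` at `0`, and `p₀' =
-a p₀`.

The decay of `p₀` is found by a bootstrap (`exists_apply_zero_le_exp_nu`). The crude bound `a ≥ μ -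
1` makes `p₀` and `W` decay at some positive rate; hence `ν - a` is bounded above by an integrable
function of time, and `p₀` decays at the rate `ν`. Returning to the inequality for `W` gives
`e^{-νt}` if `ν < 1` and at most `(1 + t) e^{-t}` up to a constant if `ν ≥ 1`. Finally `W + p₀`
controls the `ℓ¹` norm of the difference, hence the `ℓ²` norm. -/

/-- The tail mass `∑_{k ≥ n} q_k` of a probability sequence. -/
def tail (q : ℕ → ℝ) (n : ℕ) : ℝ := 1 - ∑ k ∈ Finset.range n, q k

theorem tail_succ (q : ℕ → ℝ) (n : ℕ) : tail q (n + 1) = tail q n - q n := by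
  simp only [tail, Finset.sum_range_succ]
  ring

/-- Summation by parts; once the boundary term vanishes, the mean is the sum of the tails. -/
theorem sum_tail (q : ℕ → ℝ) (N : ℕ) :
    ∑ n ∈ Finset.range N, tail q (n + 1)
      = ∑ k ∈ Finset.range N, (k : ℝ) * q k + N * tail q N := by
  induction N with
  | zero => simp
  | succ N ih =>
    rw [Finset.sum_range_succ, Finset.sum_range_succ, ih, tail_succ]
    push_cast
    ring

/-! ### Tails, mean and activity of a distribution -/

namespace ProbSeq

variable {q : ℕ → ℝ} (hq : q ∈ ProbSeq)

include hq

theorem nonneg (n : ℕ) : 0 ≤ q n := (hq.1 n).1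

theorem sum_le_one (n : ℕ) : ∑ k ∈ Finset.range n, q k ≤ 1 :=
  sum_le_hasSum _ (fun i _ => nonneg hq i) hq.2.1

theorem tail_nonneg (n : ℕ) : 0 ≤ tail q n := sub_nonneg.2 (sum_le_one hq n)

theorem hasSum_tail (n : ℕ) : HasSum (fun k => q (k + n)) (tail q n) :=
  (hasSum_nat_add_iff' n).2 hq.2.1

theorem mul_tail_le (N : ℕ) :
    (N : ℝ) * tail q N ≤ mean q - ∑ k ∈ Finset.range N, (k : ℝ) * q k := by
  refine hasSum_le (fun k => ?_) ((hasSum_tail hq N).mul_left (N : ℝ))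
    ((hasSum_nat_add_iff' N).2 hq.2.2.hasSum)
  have := nonneg hq (k + N)
  push_cast
  nlinarith [mul_nonneg (Nat.cast_nonneg (α := ℝ) k) this]

theorem tendsto_sum_mul :
    Tendsto (fun N : ℕ => ∑ k ∈ Finset.range N, (k : ℝ) * q k) atTop (𝓝 (mean q)) :=
  hq.2.2.hasSum.tendsto_sum_nat

/-- The quantity is dominated by the remainder of the convergent series for the mean. This removes
every boundary term at infinity later on. -/
theorem tendsto_mul_tail : Tendsto (fun N : ℕ => (N : ℝ) * tail q N) atTop (𝓝 0) := by
  refine squeeze_zero (fun N => mul_nonneg N.cast_nonneg (tail_nonneg hq N)) (mul_tail_le hq) ?_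
  simpa using (tendsto_sum_mul hq).const_sub (mean q)

theorem mul_tail_le_mean (N : ℕ) : (N : ℝ) * tail q N ≤ mean q :=
  (mul_tail_le hq N).trans <| sub_le_self _ <|
    Finset.sum_nonneg fun i _ => mul_nonneg i.cast_nonneg (nonneg hq i)

theorem sum_tail_le_mean (N : ℕ) : ∑ n ∈ Finset.range N, tail q (n + 1) ≤ mean q := by
  rw [sum_tail]
  linarith [mul_tail_le hq N]

theorem tendsto_sum_tail :
    Tendsto (fun N : ℕ => ∑ n ∈ Finset.range N, tail q (n + 1)) atTop (𝓝 (mean q)) := by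
  simp only [sum_tail]
  simpa using (tendsto_sum_mul hq).add (tendsto_mul_tail hq)

theorem hasSum_active :
    HasSum (fun n : ℕ => if 2 ≤ n then (n : ℝ) * q n else 0) (mean q - q 1) := by
  have h := hq.2.2.hasSum.sub (hasSum_ite_eq 1 (q 1))
  refine h.congr_fun fun n => ?_
  rcases n with _ | _ | n <;> simp

theorem active_eq : active q = mean q - q 1 := (hasSum_active hq).tsum_eq

theorem active_nonneg : 0 ≤ active q :=
  tsum_nonneg fun n => by
    split_ifs
    exacts [mul_nonneg n.cast_nonneg (nonneg hq n), le_rfl]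

end ProbSeq

/-- The divergence form telescopes, leaving the flux across the edge from `n` to `n + 1`. -/
theorem sum_generator (q : ℕ → ℝ) (n : ℕ) :
    ∑ k ∈ Finset.range (n + 1), generator q k
      = (if 2 ≤ n + 1 then ((n + 1 : ℕ) : ℝ) * q (n + 1) else 0) - active q * q n := by
  induction n with
  | zero => simp [generator_zero]
  | succ n ih =>
    rw [Finset.sum_range_succ, ih]
    simp only [generator, diffFwd, diffBwd]
    ring

/-! ### The zero-truncated Poisson equilibrium -/

section Equilibrium

variable {μ : ℝ} (hμ : 1 < μ)

include hμ

/-- Positivity comes from `W₀ ≥ -1` and `μ > 1`. The equation is `w e^w = -μ e^{-μ}` rewritten as `w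
= -μ e^{-ν}`; it says that the equilibrium has mean `μ`. -/
theorem nu_pos_and_eq : 0 < nu μ ∧ nu μ = μ * (1 - Real.exp (-nu μ)) := by
  have hx : -Real.exp (-1) ≤ -μ * Real.exp (-μ) := by
    have h1 : μ ≤ Real.exp (μ - 1) := by linarith [Real.add_one_le_exp (μ - 1)]
    have h2 : Real.exp (-1) = Real.exp (μ - 1) * Real.exp (-μ) := by
      rw [← Real.exp_add]; ring_nf
    nlinarith [Real.exp_pos (-μ)]
  obtain ⟨h1, h2⟩ := lambertW0_spec hx
  refine ⟨by unfold nu; linarith, ?_⟩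
  have h3 : Real.exp (-nu μ) = Real.exp (-μ) * Real.exp (-lambertW0 (-μ * Real.exp (-μ))) := by
    rw [← Real.exp_add, nu]; ring_nf
  have h4 : Real.exp (lambertW0 (-μ * Real.exp (-μ)))
      * Real.exp (-lambertW0 (-μ * Real.exp (-μ))) = 1 := by
    rw [← Real.exp_add]; simp
  rw [h3]
  unfold nu
  linear_combination (- lambertW0 (-μ * Real.exp (-μ))) * h4
    + Real.exp (-lambertW0 (-μ * Real.exp (-μ))) * h2

theorem nu_pos : 0 < nu μ := (nu_pos_and_eq hμ).1

theorem exp_nu_sub_one_pos : 0 < Real.exp (nu μ) - 1 := by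
  linarith [Real.add_one_le_exp (nu μ), nu_pos hμ]

theorem nu_mul_exp : nu μ * Real.exp (nu μ) = μ * (Real.exp (nu μ) - 1) := by
  have h : Real.exp (-nu μ) * Real.exp (nu μ) = 1 := by rw [← Real.exp_add]; simp
  linear_combination Real.exp (nu μ) * (nu_pos_and_eq hμ).2 - μ * h

theorem truncPoisson_nonneg (n : ℕ) : 0 ≤ truncPoisson (nu μ) n := by
  have := nu_pos hμ
  have := exp_nu_sub_one_pos hμ
  unfold truncPoisson
  split_ifs <;> positivity

omit hμ in
theorem truncPoisson_succ (ν : ℝ) (n : ℕ) :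
    truncPoisson ν (n + 1) = ν ^ (n + 1) / ((n + 1).factorial : ℝ) * (1 / (Real.exp ν - 1)) := by
  simp [truncPoisson]

omit hμ in
theorem natCast_mul_truncPoisson_succ (ν : ℝ) (n : ℕ) :
    ((n + 1 : ℕ) : ℝ) * truncPoisson ν (n + 1)
      = ν / (Real.exp ν - 1) * (ν ^ n / (n.factorial : ℝ)) := by
  rw [truncPoisson_succ, Nat.factorial_succ]
  have : (n.factorial : ℝ) ≠ 0 := by positivity
  have : (n : ℝ) + 1 ≠ 0 := by positivity
  push_cast
  field_simp
  ring

-- Detailed balance: at activity `ν` the equilibrium has zero flux across each edge.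
omit hμ in
theorem truncPoisson_balance (ν : ℝ) (n : ℕ) :
    ((n + 2 : ℕ) : ℝ) * truncPoisson ν (n + 2) = ν * truncPoisson ν (n + 1) := by
  rw [natCast_mul_truncPoisson_succ ν (n + 1), truncPoisson_succ]
  ring

omit hμ in
theorem hasSum_exp (ν : ℝ) : HasSum (fun n : ℕ => ν ^ n / (n.factorial : ℝ)) (Real.exp ν) := by
  rw [Real.exp_eq_exp_ℝ]
  exact NormedSpace.expSeries_div_hasSum_exp ν

theorem hasSum_truncPoisson : HasSum (truncPoisson (nu μ)) 1 := by
  have h := (hasSum_exp (nu μ)).sub (hasSum_ite_eq 0 (1 : ℝ))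
  have h2 := h.mul_right (1 / (Real.exp (nu μ) - 1))
  rw [mul_one_div_cancel (exp_nu_sub_one_pos hμ).ne'] at h2
  refine h2.congr_fun fun n => ?_
  rcases n with _ | n <;> simp [truncPoisson]

theorem hasSum_mul_truncPoisson : HasSum (fun n : ℕ => (n : ℝ) * truncPoisson (nu μ) n) μ := by
  rw [← hasSum_nat_add_iff' 1]
  have h := (hasSum_exp (nu μ)).mul_left (nu μ / (Real.exp (nu μ) - 1))
  rw [div_mul_eq_mul_div, nu_mul_exp hμ, mul_div_cancel_right₀ _ (exp_nu_sub_one_pos hμ).ne'] at h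
  simp_rw [natCast_mul_truncPoisson_succ]
  simpa using h

theorem truncPoisson_mem : truncPoisson (nu μ) ∈ ProbSeq :=
  ⟨fun n => ⟨truncPoisson_nonneg hμ n,
    le_hasSum (hasSum_truncPoisson hμ) n fun i _ => truncPoisson_nonneg hμ i⟩,
    hasSum_truncPoisson hμ, (hasSum_mul_truncPoisson hμ).summable⟩

theorem mean_truncPoisson : mean (truncPoisson (nu μ)) = μ := (hasSum_mul_truncPoisson hμ).tsum_eq

theorem truncPoisson_one : truncPoisson (nu μ) 1 = μ - nu μ := by
  have := exp_nu_sub_one_pos hμ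
  have h := nu_mul_exp hμ
  simp only [truncPoisson]
  simp
  field_simp
  linarith

end Equilibrium

/-- The linear part of the equation for the tails, summed over `n ≥ 2`. -/
theorem sum_linear_part (a : ℝ) (x : ℕ → ℝ) (N : ℕ) :
    ∑ n ∈ Finset.range N,
        (-(a + ((n + 2 : ℕ) : ℝ)) * x (n + 2) + a * x (n + 1) + ((n + 2 : ℕ) : ℝ) * x (n + 3))
      = -∑ n ∈ Finset.range N, x (n + 2) - x 2 + a * x 1 - a * x (N + 1)
        + ((N : ℝ) + 1) * x (N + 2) := by
  induction N with
  | zero => simp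
  | succ N ih =>
    rw [Finset.sum_range_succ, Finset.sum_range_succ, ih]
    push_cast
    ring

/-- The absolute value of a right differentiable function is right differentiable. -/
theorem hasDerivWithinAt_abs_right {f : ℝ → ℝ} {f' x : ℝ}
    (hf : HasDerivWithinAt f f' (Set.Ioi x) x) :
    ∃ d, HasDerivWithinAt (fun y => |f y|) d (Set.Ioi x) x ∧
      ∀ c g : ℝ, f' = -c * f x + g → d ≤ -c * |f x| + |g| := by
  rcases lt_trichotomy (f x) 0 with h | h | h
  · refine ⟨-f', ?_, ?_⟩
    · refine hf.neg.congr_of_eventuallyEq ?_ (abs_of_neg h)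
      filter_upwards [hf.continuousWithinAt.eventually_lt continuousWithinAt_const h] with y hy
      exact abs_of_neg hy
    · rintro c g rfl
      rw [abs_of_neg h]
      linarith [neg_le_abs g]
  -- At a zero of `f`, the right slopes of `|f|` are the absolute values of those of `f`; a
  -- two-sided derivative may fail to exist.
  · refine ⟨|f'|, ?_, ?_⟩
    · rw [hasDerivWithinAt_iff_tendsto_slope' (by simp)] at hf ⊢
      refine hf.abs.congr' ?_
      filter_upwards [self_mem_nhdsWithin] with y hy
      have : 0 < y - x := sub_pos.2 hy
      simp [slope, h, abs_mul, abs_of_pos this]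
    · rintro c g rfl
      simp [h]
  · refine ⟨f', ?_, ?_⟩
    · refine hf.congr_of_eventuallyEq ?_ (abs_of_pos h)
      filter_upwards [continuousWithinAt_const.eventually_lt hf.continuousWithinAt h] with y hy
      exact abs_of_pos hy
    · rintro c g rfl
      rw [abs_of_pos h]
      linarith [le_abs_self g]

/-! ### Evolution of the tails and conservation of the mean -/

namespace IsClassicalSolution

variable {p : ℝ → lp (fun _ : ℕ => ℝ) ⊤} (hp : IsClassicalSolution p)

include hp

theorem hasDerivWithinAt {t : ℝ} (ht : 0 ≤ t) (n : ℕ) :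
    HasDerivWithinAt (fun s => p s n) (generator (p t) n) (Set.Ici 0) t := by
  have h := (hp.contDiffOn.differentiableOn one_ne_zero t ht).hasDerivWithinAt
  rw [← hp.eq t ht n]
  exact (lp.evalCLM ℝ (fun _ : ℕ => ℝ) ⊤ n).hasFDerivAt.comp_hasDerivWithinAt t h

theorem hasDerivWithinAt_tail {t : ℝ} (ht : 0 ≤ t) (n : ℕ) :
    HasDerivWithinAt (fun s => tail (p s) (n + 1))
      (active (p t) * p t n - (if 2 ≤ n + 1 then ((n + 1 : ℕ) : ℝ) * p t (n + 1) else 0))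
      (Set.Ici 0) t := by
  have h := (HasDerivWithinAt.fun_sum fun k (_ : k ∈ Finset.range (n + 1)) =>
    hp.hasDerivWithinAt ht k).const_sub 1
  rw [sum_generator, neg_sub] at h
  exact h

theorem continuousOn_apply (n : ℕ) : ContinuousOn (fun s => p s n) (Set.Ici 0) :=
  fun _ ht => (hp.hasDerivWithinAt ht n).continuousWithinAt

theorem continuousOn_tail (n : ℕ) : ContinuousOn (fun s => tail (p s) n) (Set.Ici 0) :=
  continuousOn_const.sub (continuousOn_finsetSum _ fun k _ => hp.continuousOn_apply k)

theorem continuousOn_active : ContinuousOn (fun s => active (p s)) (Set.Ici 0) := by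
  intro t ht
  rw [ContinuousWithinAt, tendsto_iff_norm_sub_tendsto_zero]
  refine squeeze_zero' (Eventually.of_forall fun _ => norm_nonneg _) ?_ (hp.continuous t ht)
  filter_upwards [self_mem_nhdsWithin] with s hs
  have hS := hp.mem s hs
  have hT := hp.mem t ht
  have hsum : Summable fun n : ℕ => (1 + (n : ℝ)) * |p s n - p t n| := by
    refine Summable.of_nonneg_of_le (fun n => by positivity) (fun n => ?_)
      ((hS.2.1.summable.add hS.2.2).add (hT.2.1.summable.add hT.2.2))
    have h1 := ProbSeq.nonneg hS n
    have h2 := ProbSeq.nonneg hT n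
    have h3 : |p s n - p t n| ≤ p s n + p t n := abs_le.2 ⟨by linarith, by linarith⟩
    have h4 : (0 : ℝ) ≤ 1 + n := by positivity
    nlinarith [mul_le_mul_of_nonneg_left h3 h4]
  have hd := (ProbSeq.hasSum_active hS).sub (ProbSeq.hasSum_active hT)
  rw [ProbSeq.active_eq hS, ProbSeq.active_eq hT]
  have hle : ∀ n : ℕ, ‖(if 2 ≤ n then (n : ℝ) * p s n else 0)
      - (if 2 ≤ n then (n : ℝ) * p t n else 0)‖ ≤ (1 + (n : ℝ)) * |p s n - p t n| := by
    intro n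
    rw [Real.norm_eq_abs]
    split_ifs
    · rw [← mul_sub, abs_mul, Nat.abs_cast]
      exact mul_le_mul_of_nonneg_right (by linarith) (abs_nonneg _)
    · simp; positivity
  rw [← hd.tsum_eq, weightedNorm]
  exact tsum_of_norm_bounded hsum.hasSum hle

/-- The mean is the limit of truncated sums of tails. Their time derivatives tend pointwise to `a -
a = 0` and are bounded by the activity, so dominated convergence applies to the integrated identity.
-/
theorem mean_eq {t : ℝ} (ht : 0 ≤ t) : mean (p t) = mean (p 0) := by
  have hsub : Set.Icc 0 t ⊆ Set.Ici 0 := Set.Icc_subset_Ici_self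
  let d : ℕ → ℝ → ℝ := fun N s => ∑ n ∈ Finset.range N,
    (active (p s) * p s n - (if 2 ≤ n + 1 then ((n + 1 : ℕ) : ℝ) * p s (n + 1) else 0))
  have hd : ∀ N s, d N s = active (p s) * ∑ n ∈ Finset.range N, p s n
      - ∑ n ∈ Finset.range (N + 1), if 2 ≤ n then (n : ℝ) * p s n else 0 := by
    intro N s
    rw [Finset.sum_range_succ']
    simp [d, Finset.sum_sub_distrib, Finset.mul_sum]
  have hcont : ∀ N, ContinuousOn (d N) (Set.Ici 0) := by
    intro N
    refine continuousOn_finsetSum _ fun n _ =>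
      (hp.continuousOn_active.mul (hp.continuousOn_apply n)).sub ?_
    split_ifs
    exacts [continuousOn_const.mul (hp.continuousOn_apply _), continuousOn_const]
  have hint : ∀ N, ∫ s in (0 : ℝ)..t, d N s
      = ∑ n ∈ Finset.range N, tail (p t) (n + 1) - ∑ n ∈ Finset.range N, tail (p 0) (n + 1) := by
    intro N
    refine intervalIntegral.integral_eq_sub_of_hasDeriv_right_of_le
      (f := fun s => ∑ n ∈ Finset.range N, tail (p s) (n + 1)) ht
      (continuousOn_finsetSum _ fun n _ => (hp.continuousOn_tail _).mono hsub) (fun s hs => ?_)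
      (((hcont N).mono hsub).intervalIntegrable_of_Icc ht)
    exact HasDerivWithinAt.fun_sum fun n _ => (hp.hasDerivWithinAt_tail hs.1.le n).mono
      (Set.Ioi_subset_Ici hs.1.le)
  have hlim : Tendsto (fun N => ∫ s in (0 : ℝ)..t, d N s) atTop (𝓝 (∫ _ in (0 : ℝ)..t, (0 : ℝ))) := by
    refine intervalIntegral.tendsto_integral_filter_of_dominated_convergence
      (fun s => active (p s)) (Eventually.of_forall fun N => ?_)
      (Eventually.of_forall fun N => Eventually.of_forall fun s hs => ?_)
      ((hp.continuousOn_active.mono hsub).intervalIntegrable_of_Icc ht)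
      (Eventually.of_forall fun s hs => ?_)
    · rw [Set.uIoc_of_le ht]
      exact ((hcont N).mono (Set.Ioc_subset_Icc_self.trans hsub)).aestronglyMeasurable
        measurableSet_Ioc
    · rw [Set.uIoc_of_le ht] at hs
      have hq := hp.mem s hs.1.le
      have h0 : ∀ n : ℕ, 0 ≤ if 2 ≤ n then (n : ℝ) * p s n else 0 := fun n => by
        split_ifs
        exacts [mul_nonneg n.cast_nonneg (ProbSeq.nonneg hq n), le_rfl]
      have h1 : ∑ n ∈ Finset.range (N + 1), (if 2 ≤ n then (n : ℝ) * p s n else 0)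
          ≤ active (p s) := by
        rw [ProbSeq.active_eq hq]
        exact sum_le_hasSum _ (fun i _ => h0 i) (ProbSeq.hasSum_active hq)
      have h2 := Finset.sum_nonneg fun n (_ : n ∈ Finset.range (N + 1)) => h0 n
      have h3 := ProbSeq.active_nonneg hq
      have h4 := mul_le_mul_of_nonneg_left (ProbSeq.sum_le_one hq N) h3
      have h5 := mul_nonneg h3
        (Finset.sum_nonneg fun n (_ : n ∈ Finset.range N) => ProbSeq.nonneg hq n)
      rw [hd, Real.norm_eq_abs]
      exact abs_le.2 ⟨by linarith, by linarith⟩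
    · rw [Set.uIoc_of_le ht] at hs
      have hq := hp.mem s hs.1.le
      simp only [hd]
      have h1 := hq.2.1.tendsto_sum_nat.const_mul (active (p s))
      have h2 := ((ProbSeq.hasSum_active hq).tendsto_sum_nat).comp (tendsto_add_atTop_nat 1)
      have h3 := h1.sub h2
      rw [ProbSeq.active_eq hq, mul_one, sub_self] at h3
      rw [ProbSeq.active_eq hq]
      exact h3
  have hlim' := (ProbSeq.tendsto_sum_tail (hp.mem t ht)).sub
    (ProbSeq.tendsto_sum_tail (hp.mem 0 le_rfl))
  simp only [hint] at hlim
  have := tendsto_nhds_unique hlim' hlim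
  simp at this
  linarith

end IsClassicalSolution

/-! ### Static estimates for the tail differences -/

/-- The difference between the tails of `q` and those of the equilibrium of mean `μ`. -/
noncomputable def tailDiff (μ : ℝ) (q : ℕ → ℝ) (n : ℕ) : ℝ := tail q n - tail (truncPoisson (nu μ)) n

theorem tailDiff_zero (μ : ℝ) (q : ℕ → ℝ) : tailDiff μ q 0 = 0 := by simp [tailDiff, tail]

theorem tailDiff_one (μ : ℝ) (q : ℕ → ℝ) : tailDiff μ q 1 = -q 0 := by
  simp [tailDiff, tail, truncPoisson]

theorem tailDiff_succ (μ : ℝ) (q : ℕ → ℝ) (n : ℕ) :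
    tailDiff μ q (n + 1) = tailDiff μ q n - (q n - truncPoisson (nu μ) n) := by
  simp only [tailDiff, tail_succ]
  ring

section

variable {μ : ℝ} (hμ : 1 < μ) {q : ℕ → ℝ} (hq : q ∈ ProbSeq) (hm : mean q = μ)

include hμ hq hm

/-- Both activities are the mean minus the mass at `1`, and the means agree. This turns the
nonlinearity into a term that the damping can absorb. -/
theorem active_sub_nu : active q - nu μ = tailDiff μ q 2 - tailDiff μ q 1 := by
  rw [tailDiff_succ μ q 1, ProbSeq.active_eq hq, hm, truncPoisson_one hμ]
  ring

omit hm in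
theorem abs_tailDiff_le (n : ℕ) :
    |tailDiff μ q n| ≤ tail q n + tail (truncPoisson (nu μ)) n := by
  have h1 := ProbSeq.tail_nonneg hq n
  have h2 := ProbSeq.tail_nonneg (truncPoisson_mem hμ) n
  exact abs_le.2 ⟨by unfold tailDiff; linarith, by unfold tailDiff; linarith⟩

theorem sum_abs_tailDiff_le (N : ℕ) :
    ∑ n ∈ Finset.range N, |tailDiff μ q (n + 2)| ≤ 2 * μ := by
  have h1 := ProbSeq.sum_tail_le_mean hq (N + 1)
  have h2 := ProbSeq.sum_tail_le_mean (truncPoisson_mem hμ) (N + 1)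
  rw [hm, Finset.sum_range_succ'] at h1
  rw [mean_truncPoisson hμ, Finset.sum_range_succ'] at h2
  have h3 := ProbSeq.tail_nonneg hq 1
  have h4 := ProbSeq.tail_nonneg (truncPoisson_mem hμ) 1
  have h5 := Finset.sum_le_sum fun n (_ : n ∈ Finset.range N) => abs_tailDiff_le hμ hq (n + 2)
  rw [Finset.sum_add_distrib] at h5
  linarith

theorem mul_abs_tailDiff_le (N : ℕ) : (N : ℝ) * |tailDiff μ q N| ≤ 2 * μ := by
  have h1 := ProbSeq.mul_tail_le_mean hq N
  have h2 := ProbSeq.mul_tail_le_mean (truncPoisson_mem hμ) N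
  rw [mean_truncPoisson hμ] at h2
  have h3 := mul_le_mul_of_nonneg_left (abs_tailDiff_le hμ hq N) N.cast_nonneg
  linarith

omit hm in
theorem tendsto_mul_abs_tailDiff :
    Tendsto (fun N : ℕ => (N : ℝ) * |tailDiff μ q N|) atTop (𝓝 0) := by
  have h := (ProbSeq.tendsto_mul_tail hq).add (ProbSeq.tendsto_mul_tail (truncPoisson_mem hμ))
  rw [add_zero] at h
  refine squeeze_zero (fun N => by positivity) (fun N => ?_) h
  rw [← mul_add]
  exact mul_le_mul_of_nonneg_left (abs_tailDiff_le hμ hq N) N.cast_nonneg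

omit hμ in
theorem active_bounds : μ - 1 ≤ active q ∧ active q ≤ μ := by
  rw [ProbSeq.active_eq hq, hm]
  exact ⟨by linarith [(hq.1 1).2], by linarith [(hq.1 1).1]⟩

theorem abs_active_sub_nu_le (N : ℕ) :
    |active q - nu μ| ≤ ∑ n ∈ Finset.range (N + 1), |tailDiff μ q (n + 2)| + q 0 := by
  have h1 : |tailDiff μ q 2| ≤ ∑ n ∈ Finset.range (N + 1), |tailDiff μ q (n + 2)| :=
    Finset.single_le_sum (f := fun n => |tailDiff μ q (n + 2)|) (fun _ _ => abs_nonneg _)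
      (Finset.mem_range.2 N.succ_pos)
  have h2 := abs_sub (tailDiff μ q 2) (tailDiff μ q 1)
  rw [active_sub_nu hμ hq hm]
  rw [tailDiff_one, abs_neg, abs_of_nonneg (ProbSeq.nonneg hq 0)] at h2
  rw [tailDiff_one]
  linarith

-- Each mass difference is a difference of consecutive tail differences, with `x 0 = 0` and `|x 1| =
-- q 0`.
omit hμ hm in
theorem sum_abs_sub_le (N : ℕ) :
    ∑ n ∈ Finset.range N, |q n - truncPoisson (nu μ) n|
      ≤ 2 * (∑ n ∈ Finset.range N, |tailDiff μ q (n + 2)| + q 0) := by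
  have h1 : ∀ n, |q n - truncPoisson (nu μ) n| ≤ |tailDiff μ q n| + |tailDiff μ q (n + 1)| := by
    intro n
    rw [show q n - truncPoisson (nu μ) n = tailDiff μ q n - tailDiff μ q (n + 1) by
      rw [tailDiff_succ]; ring]
    exact abs_sub _ _
  have h2 := Finset.sum_le_sum fun n (_ : n ∈ Finset.range N) => h1 n
  rw [Finset.sum_add_distrib] at h2
  have h0 : |tailDiff μ q 1| = q 0 := by
    rw [tailDiff_one, abs_neg, abs_of_nonneg (ProbSeq.nonneg hq 0)]
  have h3 : ∑ n ∈ Finset.range N, |tailDiff μ q (n + 1)|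
      ≤ ∑ n ∈ Finset.range N, |tailDiff μ q (n + 2)| + q 0 := by
    have := Finset.sum_range_succ' (fun n => |tailDiff μ q (n + 1)|) N
    rw [Finset.sum_range_succ] at this
    simp only [zero_add, h0, add_assoc, Nat.reduceAdd] at this ⊢
    linarith [abs_nonneg (tailDiff μ q (N + 1))]
  have h4 : ∑ n ∈ Finset.range N, |tailDiff μ q n|
      ≤ ∑ n ∈ Finset.range N, |tailDiff μ q (n + 1)| := by
    have := Finset.sum_range_succ' (fun n => |tailDiff μ q n|) N
    rw [Finset.sum_range_succ, tailDiff_zero, abs_zero] at this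
    linarith [abs_nonneg (tailDiff μ q N)]
  linarith

end

/-! ### The differential inequality for the summed tail differences -/

namespace IsClassicalSolution

variable {μ : ℝ} (hμ : 1 < μ) {p : ℝ → lp (fun _ : ℕ => ℝ) ⊤} (hp : IsClassicalSolution p)

include hp

theorem continuousOn_tailDiff (n : ℕ) :
    ContinuousOn (fun s => tailDiff μ (p s) n) (Set.Ici 0) :=
  (hp.continuousOn_tail n).sub continuousOn_const

theorem hasDerivWithinAt_tailDiff {t : ℝ} (ht : 0 ≤ t) (n : ℕ) :
    HasDerivWithinAt (fun s => tailDiff μ (p s) (n + 2))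
      (-(active (p t) + ((n + 2 : ℕ) : ℝ)) * tailDiff μ (p t) (n + 2)
        + (active (p t) * tailDiff μ (p t) (n + 1)
          + ((n + 2 : ℕ) : ℝ) * tailDiff μ (p t) (n + 3)
          + (active (p t) - nu μ) * truncPoisson (nu μ) (n + 1))) (Set.Ici 0) t := by
  have h := (hp.hasDerivWithinAt_tail ht (n + 1)).sub_const (tail (truncPoisson (nu μ)) (n + 2))
  rw [if_pos (by omega)] at h
  refine h.congr_deriv ?_
  have h1 := truncPoisson_balance (nu μ) n
  have h2 := tailDiff_succ μ (p t) (n + 1)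
  have h3 := tailDiff_succ μ (p t) (n + 2)
  simp only [add_assoc, Nat.reduceAdd] at h1 h2 h3 ⊢
  linear_combination active (p t) * h2 - ((n + 2 : ℕ) : ℝ) * h3 - h1

variable (hm : mean (p 0) = μ)

include hμ hm

/-- Gronwall for `W' ≤ -W + (μ + 1) p₀`, done on truncations at `N`. The boundary term `e N` tends
to `0` pointwise and is at most `2 * μ`, so it disappears by dominated convergence; the initial sum
is also at most `2 * μ`, whatever the initial value. -/
theorem exp_mul_sum_le {t : ℝ} (ht : 0 ≤ t) (M : ℕ) :
    Real.exp t * ∑ n ∈ Finset.range M, |tailDiff μ (p t) (n + 2)|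
      ≤ 2 * μ + (μ + 1) * ∫ s in (0 : ℝ)..t, Real.exp s * p s 0 := by
  have hsub : Set.Icc 0 t ⊆ Set.Ici 0 := Set.Icc_subset_Ici_self
  have hmean : ∀ s, 0 ≤ s → mean (p s) = μ := fun s hs => (hp.mean_eq hs).trans hm
  let W : ℕ → ℝ → ℝ := fun N s => ∑ n ∈ Finset.range N, |tailDiff μ (p s) (n + 2)|
  let e : ℕ → ℝ → ℝ := fun N s => ((N + 2 : ℕ) : ℝ) * |tailDiff μ (p s) (N + 2)|
  let φ : ℕ → ℝ → ℝ := fun N s => Real.exp s * ((μ + 1) * p s 0 + e N s)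
  have hWc : ∀ N, ContinuousOn (W N) (Set.Ici 0) := fun N =>
    continuousOn_finsetSum _ fun n _ => (hp.continuousOn_tailDiff _).abs
  have hec : ∀ N, ContinuousOn (e N) (Set.Ici 0) := fun N =>
    continuousOn_const.mul (hp.continuousOn_tailDiff _).abs
  have hφc : ∀ N, ContinuousOn (φ N) (Set.Ici 0) := fun N =>
    Real.continuous_exp.continuousOn.mul
      ((continuousOn_const.mul (hp.continuousOn_apply 0)).add (hec N))
  have hderiv : ∀ N, 0 < N → ∀ s, 0 ≤ s → ∃ d, HasDerivWithinAt (W N) d (Set.Ioi s) s ∧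
      d ≤ -W N s + ((μ + 1) * p s 0 + e N s) := by
    intro N hN s hs
    have hq := hp.mem s hs
    have ha := active_bounds hq (hmean s hs)
    have ha0 := ProbSeq.active_nonneg hq
    choose d hd hdle using fun n : ℕ => hasDerivWithinAt_abs_right
      ((hp.hasDerivWithinAt_tailDiff (μ := μ) hs n).mono (Set.Ioi_subset_Ici hs))
    refine ⟨∑ n ∈ Finset.range N, d n, HasDerivWithinAt.fun_sum fun n _ => hd n, ?_⟩
    set a := active (p s)
    set x : ℕ → ℝ := fun n => |tailDiff μ (p s) n|
    have h1 : ∀ n, d n ≤ (-(a + ((n + 2 : ℕ) : ℝ)) * x (n + 2) + a * x (n + 1)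
        + ((n + 2 : ℕ) : ℝ) * x (n + 3)) + |a - nu μ| * truncPoisson (nu μ) (n + 1) := by
      intro n
      refine (hdle n _ _ rfl).trans ?_
      have h2 := abs_add_three (a * tailDiff μ (p s) (n + 1))
        (((n + 2 : ℕ) : ℝ) * tailDiff μ (p s) (n + 3)) ((a - nu μ) * truncPoisson (nu μ) (n + 1))
      rw [abs_mul, abs_mul, abs_mul, abs_of_nonneg ha0, Nat.abs_cast,
        abs_of_nonneg (truncPoisson_nonneg hμ _)] at h2
      linarith
    have h2 := Finset.sum_le_sum fun n (_ : n ∈ Finset.range N) => h1 n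
    rw [Finset.sum_add_distrib, sum_linear_part, ← Finset.mul_sum] at h2
    have h3 : ∑ n ∈ Finset.range N, truncPoisson (nu μ) (n + 1) ≤ 1 := by
      have := ProbSeq.sum_le_one (truncPoisson_mem hμ) (N + 1)
      rw [Finset.sum_range_succ'] at this
      linarith [truncPoisson_nonneg hμ 0]
    have h4 := mul_le_mul_of_nonneg_left h3 (abs_nonneg (a - nu μ))
    -- This `x 2` is cancelled exactly by the `- x 2` of `sum_linear_part`, so the full damping rate
    -- `1` survives.
    have h5 : |a - nu μ| ≤ x 2 + x 1 := by
      rw [active_sub_nu hμ hq (hmean s hs)]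
      exact abs_sub _ _
    have h6 : x 1 = p s 0 := by
      simp only [x, tailDiff_one, abs_neg, abs_of_nonneg (ProbSeq.nonneg hq 0)]
    have h7 : 0 ≤ a * x (N + 1) := mul_nonneg ha0 (abs_nonneg _)
    have h8 : ((N : ℝ) + 1) * x (N + 2) ≤ e N s := by
      refine mul_le_mul_of_nonneg_right ?_ (abs_nonneg _)
      push_cast
      linarith
    have h9 : a * p s 0 ≤ μ * p s 0 := mul_le_mul_of_nonneg_right ha.2 (ProbSeq.nonneg hq 0)
    have hW : W N s = ∑ n ∈ Finset.range N, x (n + 2) := rfl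
    rw [h6] at h2 h5
    linarith
  have hineq : ∀ N, 0 < N → Real.exp t * W N t - Real.exp 0 * W N 0 ≤ ∫ s in (0 : ℝ)..t, φ N s := by
    intro N hN
    choose! d hd hdle using hderiv N hN
    refine intervalIntegral.sub_le_integral_of_hasDeriv_right_of_le
      (g := fun s => Real.exp s * W N s) (g' := fun s => Real.exp s * W N s + Real.exp s * d s) ht
      (Real.continuous_exp.continuousOn.mul ((hWc N).mono hsub))
      (fun s hs => (Real.hasDerivAt_exp s).hasDerivWithinAt.mul (hd s hs.1.le))
      ((hφc N).mono hsub).integrableOn_Icc (fun s hs => ?_)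
    have := mul_le_mul_of_nonneg_left (hdle s hs.1.le) (Real.exp_pos s).le
    simp only [φ]
    linarith
  have hlim : Tendsto (fun N => ∫ s in (0 : ℝ)..t, φ N s) atTop
      (𝓝 (∫ s in (0 : ℝ)..t, Real.exp s * ((μ + 1) * p s 0 + 0))) := by
    refine intervalIntegral.tendsto_integral_filter_of_dominated_convergence
      (fun s => Real.exp s * ((μ + 1) * p s 0 + 2 * μ)) (Eventually.of_forall fun N => ?_)
      (Eventually.of_forall fun N => Eventually.of_forall fun s hs => ?_)
      (ContinuousOn.intervalIntegrable_of_Icc ht ?_)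
      (Eventually.of_forall fun s hs => ?_)
    · rw [Set.uIoc_of_le ht]
      exact ((hφc N).mono (Set.Ioc_subset_Icc_self.trans hsub)).aestronglyMeasurable
        measurableSet_Ioc
    · rw [Set.uIoc_of_le ht] at hs
      have hq := hp.mem s hs.1.le
      have h0 := ProbSeq.nonneg hq 0
      have h1 := mul_abs_tailDiff_le hμ hq (hmean s hs.1.le) (N + 2)
      have h2 : 0 ≤ (μ + 1) * p s 0 + e N s := by positivity
      rw [Real.norm_eq_abs, abs_of_nonneg (mul_nonneg (Real.exp_pos s).le h2)]
      exact mul_le_mul_of_nonneg_left (by linarith) (Real.exp_pos s).le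
    · exact Real.continuous_exp.continuousOn.mul ((continuousOn_const.mul
        ((hp.continuousOn_apply 0).mono hsub)).add continuousOn_const)
    · rw [Set.uIoc_of_le ht] at hs
      have h := (tendsto_mul_abs_tailDiff hμ (hp.mem s hs.1.le)).comp
        (tendsto_add_atTop_nat 2)
      exact (h.const_add _).const_mul _
  -- `M` stays fixed while the truncation `N` goes to infinity.
  have hle := ge_of_tendsto (b := Real.exp t * W M t - 2 * μ) hlim <| by
    filter_upwards [eventually_ge_atTop (M + 1)] with N hN
    refine le_trans ?_ (hineq N (by omega))
    have h1 : W M t ≤ W N t := Finset.sum_le_sum_of_subset_of_nonneg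
      (Finset.range_mono (by omega)) fun _ _ _ => abs_nonneg _
    have h2 := sum_abs_tailDiff_le hμ (hp.mem 0 le_rfl) hm N
    have h3 := mul_le_mul_of_nonneg_left h1 (Real.exp_pos t).le
    rw [Real.exp_zero, one_mul]
    linarith
  have hfin : ∫ s in (0 : ℝ)..t, Real.exp s * ((μ + 1) * p s 0 + 0)
      = (μ + 1) * ∫ s in (0 : ℝ)..t, Real.exp s * p s 0 := by
    rw [← intervalIntegral.integral_const_mul]
    congr 1
    ext s
    ring
  rw [hfin] at hle
  linarith

end IsClassicalSolution

/-- A sequence whose absolute partial sums are bounded by `B` has `ℓ²` norm at most `B`. -/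
theorem exists_memℓp_two_norm_le {f : ℕ → ℝ} {B : ℝ}
    (hB : ∀ N : ℕ, ∑ n ∈ Finset.range N, |f n| ≤ B) :
    ∃ h : Memℓp f 2, ‖(⟨f, h⟩ : lp (fun _ : ℕ => ℝ) 2)‖ ≤ B := by
  have hB0 : 0 ≤ B := by simpa using hB 0
  have hs : ∀ s : Finset ℕ, ∑ n ∈ s, |f n| ≤ B := fun s => by
    obtain ⟨N, hN⟩ := s.exists_nat_subset_range
    exact (Finset.sum_le_sum_of_subset_of_nonneg hN fun _ _ _ => abs_nonneg _).trans (hB N)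
  have hsq : ∀ s : Finset ℕ, ∑ n ∈ s, ‖f n‖ ^ (2 : ENNReal).toReal ≤ B ^ (2 : ENNReal).toReal := by
    intro s
    simp only [ENNReal.toReal_ofNat, Real.rpow_ofNat, Real.norm_eq_abs]
    calc ∑ n ∈ s, |f n| ^ 2 ≤ ∑ n ∈ s, B * |f n| := Finset.sum_le_sum fun n _ => by
          have : |f n| ≤ B := by simpa using hs {n}
          rw [sq]
          exact mul_le_mul_of_nonneg_right this (abs_nonneg _)
      _ ≤ B ^ 2 := by
          rw [← Finset.mul_sum, sq]
          exact mul_le_mul_of_nonneg_left (hs s) hB0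
  exact ⟨memℓp_gen' hsq, lp.norm_le_of_forall_sum_le (by simp) hB0 hsq⟩

/-! ### Decay of the mass at `0` and its feedback on the tails -/

namespace IsClassicalSolution

variable {p : ℝ → lp (fun _ : ℕ => ℝ) ⊤} (hp : IsClassicalSolution p)

include hp

/-- The mass at `0` decays at least as fast as any lower bound of the activity dictates. -/
theorem apply_zero_le {h h' : ℝ → ℝ} (hh : ∀ t, HasDerivAt h (h' t) t)
    (hle : ∀ t, 0 ≤ t → h' t ≤ active (p t)) {t : ℝ} (ht : 0 ≤ t) :
    p t 0 ≤ Real.exp (h 0 - h t) := by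
  have hd : ∀ s, 0 ≤ s → HasDerivWithinAt (fun s => p s 0 * Real.exp (h s))
      (generator (p s) 0 * Real.exp (h s) + p s 0 * (Real.exp (h s) * h' s)) (Set.Ici 0) s :=
    fun s hs => (hp.hasDerivWithinAt hs 0).mul (hh s).exp.hasDerivWithinAt
  have hanti : AntitoneOn (fun s => p s 0 * Real.exp (h s)) (Set.Ici 0) := by
    refine antitoneOn_of_hasDerivWithinAt_nonpos (convex_Ici 0)
      (fun s hs => (hd s hs).continuousWithinAt)
      (fun s hs => (hd s (interior_subset hs)).mono interior_subset) fun s hs => ?_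
    have hs0 : 0 ≤ s := interior_subset hs
    have h1 := mul_nonneg (mul_nonneg (ProbSeq.nonneg (hp.mem s hs0) 0) (Real.exp_pos (h s)).le)
      (sub_nonneg.2 (hle s hs0))
    rw [generator_zero]
    linarith
  have h1 : p t 0 * Real.exp (h t) ≤ p 0 0 * Real.exp (h 0) :=
    hanti (Set.mem_Ici.2 le_rfl) (Set.mem_Ici.2 ht) ht
  rw [Real.exp_sub, le_div_iff₀ (Real.exp_pos _)]
  exact h1.trans (mul_le_of_le_one_left (Real.exp_pos _).le ((hp.mem 0 le_rfl).1 0).2)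

theorem integral_exp_mul_le {g G : ℝ → ℝ} (hg : Continuous g) (hG : ∀ t, HasDerivAt G (g t) t)
    (hle : ∀ t, 0 ≤ t → Real.exp t * p t 0 ≤ g t) {t : ℝ} (ht : 0 ≤ t) :
    ∫ s in (0 : ℝ)..t, Real.exp s * p s 0 ≤ G t - G 0 := by
  rw [← intervalIntegral.integral_eq_sub_of_hasDerivAt (fun s _ => hG s)
    (hg.intervalIntegrable 0 t)]
  refine intervalIntegral.integral_mono_on ht (ContinuousOn.intervalIntegrable_of_Icc ht ?_)
    (hg.intervalIntegrable 0 t) fun s hs => hle s hs.1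
  exact Real.continuous_exp.continuousOn.mul
    ((hp.continuousOn_apply 0).mono Set.Icc_subset_Ici_self)

variable {μ : ℝ} (hμ : 1 < μ) (hm : mean (p 0) = μ)

include hμ hm

/-- For `r < 1` the integral of `e^{(1 - r)s}` is controlled by its upper end, so the tails inherit
the rate of `p₀`. Used twice: with the crude rate, then with `ν`. -/
theorem sum_abs_tailDiff_le_exp {A r : ℝ} (hA : 0 ≤ A) (hr : r < 1)
    (h0 : ∀ t, 0 ≤ t → p t 0 ≤ A * Real.exp (-r * t)) {t : ℝ} (ht : 0 ≤ t) (M : ℕ) :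
    ∑ n ∈ Finset.range M, |tailDiff μ (p t) (n + 2)|
      ≤ (2 * μ + (μ + 1) * (A / (1 - r))) * Real.exp (-r * t) := by
  have hr' : 0 < 1 - r := sub_pos.2 hr
  have h1 := hp.exp_mul_sum_le hμ hm ht M
  have h2 := hp.integral_exp_mul_le (g := fun t => A * Real.exp ((1 - r) * t))
    (G := fun t => A / (1 - r) * Real.exp ((1 - r) * t)) (by fun_prop)
    (fun t => by
      refine ((((hasDerivAt_id t).const_mul (1 - r)).exp).const_mul (A / (1 - r))).congr_deriv ?_
      simp only [id]
      field_simp)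
    (fun s hs => by
      have := mul_le_mul_of_nonneg_left (h0 s hs) (Real.exp_pos s).le
      rw [show (1 - r) * s = s + -r * s by ring, Real.exp_add]
      linarith) ht
  have h3 : 0 ≤ A / (1 - r) := by positivity
  have h4 : Real.exp ((1 - r) * t) = Real.exp t * Real.exp (-r * t) := by
    rw [← Real.exp_add]; ring_nf
  have h5 : 1 ≤ Real.exp ((1 - r) * t) := Real.one_le_exp (by positivity)
  simp only [mul_zero, Real.exp_zero, mul_one] at h2
  have h6 : ∫ s in (0 : ℝ)..t, Real.exp s * p s 0 ≤ A / (1 - r) * Real.exp ((1 - r) * t) := by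
    linarith
  have h7 := mul_le_mul_of_nonneg_left h6 (by linarith : (0 : ℝ) ≤ μ + 1)
  have h8 := mul_le_mul_of_nonneg_left h5 (by linarith : (0 : ℝ) ≤ 2 * μ)
  refine le_of_mul_le_mul_left ?_ (Real.exp_pos t)
  rw [h4] at h7 h8
  linarith

end IsClassicalSolution

/-- The mass at `0` decays at the rate `ν`, uniformly in the initial value. -/
theorem exists_apply_zero_le_exp_nu {μ : ℝ} (hμ : 1 < μ) :
    ∃ A : ℝ, 0 < A ∧ ∀ p : ℝ → lp (fun _ : ℕ => ℝ) ⊤, IsClassicalSolution p → mean (p 0) = μ →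
      ∀ t, 0 ≤ t → p t 0 ≤ A * Real.exp (-nu μ * t) := by
  -- The crude rate must not exceed `μ - 1` and must stay below the damping rate `1`; the cap `1 /
  -- 2` is arbitrary.
  obtain ⟨r, hr0, hr1, hrμ⟩ : ∃ r : ℝ, 0 < r ∧ r < 1 ∧ r ≤ μ - 1 :=
    ⟨min (μ - 1) (1 / 2), lt_min (by linarith) (by norm_num),
      (min_le_right _ _).trans_lt (by norm_num), min_le_left _ _⟩
  -- The tail constant for `A = 1`, plus `1` for the mass at `0`: together they bound `|a - ν|`.
  set B : ℝ := 2 * μ + (μ + 1) * (1 / (1 - r)) + 1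
  have hB : 0 ≤ B := by
    have : 0 < 1 - r := by linarith
    positivity
  refine ⟨Real.exp (B / r), Real.exp_pos _, fun p hp hm t ht => ?_⟩
  have h1 : ∀ t, 0 ≤ t → p t 0 ≤ 1 * Real.exp (-r * t) := fun t ht => by
    have := hp.apply_zero_le (h := fun t => r * t) (h' := fun _ => r)
      (fun t => by simpa using (hasDerivAt_id t).const_mul r)
      (fun t ht => hrμ.trans (active_bounds (hp.mem t ht) ((hp.mean_eq ht).trans hm)).1) ht
    rw [one_mul]
    convert this using 2
    ring
  have h2 : ∀ t, 0 ≤ t → nu μ - B * Real.exp (-r * t) ≤ active (p t) := fun t ht => by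
    have h3 := hp.sum_abs_tailDiff_le_exp hμ hm zero_le_one hr1 h1 ht 1
    have h4 := abs_active_sub_nu_le hμ (hp.mem t ht) ((hp.mean_eq ht).trans hm) 0
    have h5 := neg_abs_le (active (p t) - nu μ)
    have h6 := h1 t ht
    rw [zero_add] at h4
    simp only [B, add_mul]
    linarith
  -- The error `B e^{-rt}` has total integral `B / r`, whence the prefactor `exp (B / r)`.
  refine (hp.apply_zero_le (h := fun t => nu μ * t + B / r * Real.exp (-r * t))
    (h' := fun t => nu μ - B * Real.exp (-r * t)) (fun t => ?_) h2 ht).trans ?_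
  · refine (((hasDerivAt_id t).const_mul (nu μ)).add
      ((((hasDerivAt_id t).const_mul (-r)).exp).const_mul (B / r))).congr_deriv ?_
    simp only [id]
    field_simp
    ring
  · rw [← Real.exp_add]
    refine Real.exp_le_exp.2 ?_
    have : 0 ≤ B / r * Real.exp (-r * t) := by positivity
    simp only [mul_zero, Real.exp_zero]
    linarith

end Dispersion

/-! ### Conclusion in the two regimes -/

theorem theorem4p10 (μ : ℝ) (hμ : 1 < μ) :
    ∃ C K : ℝ, 0 < C ∧ 0 < K ∧
      ∀ p : ℝ → lp (fun _ : ℕ => ℝ) ⊤,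
        Dispersion.IsClassicalSolution p → Dispersion.mean (p 0) = μ →
        ∀ t : ℝ, 0 ≤ t →
          ∃ h : Memℓp (fun n : ℕ => p t n - Dispersion.truncPoisson (Dispersion.nu μ) n) 2,
            (Dispersion.nu μ < 1 →
              ‖(⟨_, h⟩ : lp (fun _ : ℕ => ℝ) 2)‖ ≤ C * Real.exp (-Dispersion.nu μ * t)) ∧
            (1 ≤ Dispersion.nu μ →
              ‖(⟨_, h⟩ : lp (fun _ : ℕ => ℝ) 2)‖
                ≤ C * Dispersion.bracket t ^ K * Real.exp (-t)) := by
  obtain ⟨A, hA, hA0⟩ := Dispersion.exists_apply_zero_le_exp_nu hμ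
  rcases lt_or_ge (Dispersion.nu μ) 1 with hν | hν
  · have hν' : 0 < 1 - Dispersion.nu μ := sub_pos.2 hν
    refine ⟨2 * (2 * μ + (μ + 1) * (A / (1 - Dispersion.nu μ)) + A), 1, by positivity, one_pos,
      fun p hp hm t ht => ?_⟩
    obtain ⟨h, hle⟩ := Dispersion.exists_memℓp_two_norm_le
      (f := fun n : ℕ => p t n - Dispersion.truncPoisson (Dispersion.nu μ) n)
      (B := 2 * (2 * μ + (μ + 1) * (A / (1 - Dispersion.nu μ)) + A)
        * Real.exp (-Dispersion.nu μ * t)) fun N => by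
        refine (Dispersion.sum_abs_sub_le (hp.mem t ht) N).trans ?_
        have h1 := hp.sum_abs_tailDiff_le_exp hμ hm hA.le hν (hA0 p hp hm) ht N
        have h2 := hA0 p hp hm t ht
        linarith
    exact ⟨h, fun _ => hle, fun hν1 => absurd hν1 hν.not_ge⟩
  -- Here `e^s p₀(s) ≤ A`, so the integral grows at most linearly and `K = 1` suffices, even at `ν =
  -- 1`.
  · refine ⟨2 * (2 * μ + (μ + 1) * A + A), 1, by positivity, one_pos, fun p hp hm t ht => ?_⟩
    obtain ⟨h, hle⟩ := Dispersion.exists_memℓp_two_norm_le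
      (f := fun n : ℕ => p t n - Dispersion.truncPoisson (Dispersion.nu μ) n)
      (B := 2 * (2 * μ + (μ + 1) * A + A) * Dispersion.bracket t ^ (1 : ℝ) * Real.exp (-t)) fun N => by
        refine (Dispersion.sum_abs_sub_le (hp.mem t ht) N).trans ?_
        have hb1 : 1 ≤ Dispersion.bracket t := Real.one_le_sqrt.2 (by nlinarith)
        have hbt : t ≤ Dispersion.bracket t := Real.le_sqrt_of_sq_le (by linarith)
        have h0 : ∀ s, 0 ≤ s → p s 0 ≤ A * Real.exp (-s) := fun s hs =>
          (hA0 p hp hm s hs).trans <| mul_le_mul_of_nonneg_left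
            (Real.exp_le_exp.2 (by nlinarith)) hA.le
        have hexp : ∀ s : ℝ, Real.exp s * Real.exp (-s) = 1 := fun s => by
          rw [← Real.exp_add]; simp
        have h1 := hp.integral_exp_mul_le (g := fun _ => A) (G := fun s => A * s)
          continuous_const (fun s => by simpa using (hasDerivAt_id s).const_mul A)
          (fun s hs => by
            have := mul_le_mul_of_nonneg_left (h0 s hs) (Real.exp_pos s).le
            linear_combination this + A * hexp s) ht
        have h2 := hp.exp_mul_sum_le hμ hm ht N
        have h3 := mul_le_mul_of_nonneg_left h1 (by linarith : (0 : ℝ) ≤ μ + 1)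
        have h4 := mul_le_mul_of_nonneg_left (h0 t ht) (Real.exp_pos t).le
        have h5 := mul_le_mul_of_nonneg_left hb1 (by linarith : 0 ≤ 2 * μ + A)
        have h6 := mul_le_mul_of_nonneg_left hbt (by positivity : 0 ≤ (μ + 1) * A)
        rw [Real.rpow_one]
        refine le_of_mul_le_mul_left ?_ (Real.exp_pos t)
        linear_combination 2 * h2 + 2 * h3 + 2 * h4 + 2 * h5 + 2 * h6
          + (2 * A - 2 * (2 * μ + (μ + 1) * A + A) * Dispersion.bracket t) * hexp t
    exact ⟨h, fun hν1 => absurd hν hν1.not_ge, fun _ => hle⟩
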